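/- **Theorem (lower bounds for drifting distributions).** A learner has $K\ge 2$ actions and plays $T$ steps. An environment consists of probability distributions $D_{t,i}$ on $[0,1]$ ($1\le t\le T$, $1\le i\le K$); the losses $\ell_{t,i}\sim D_{t,i}$ are drawn independently over all $t$ and $i$. Let $\mu_{t,i}=\mathbb{E}[\ell_{t,i}]$, $\mu_t=(\mu_{t,1},\dots,\mu_{t,K})$, $\mu_0=0$. The total drift of the environment is $\sum_{t=1}^T\|\mu_t-\mu_{t-1}\|_\infty$ and its total variance is $\sum_{t=1}^T\mathbb{E}\,\|\ell_t-\mu_t\|_2^2$. At step $t$ a (possibly randomized) algorithm chooses an action $a_t$, using its internal randomness (which is independent of the losses) and the feedback of the earlier steps: the whole vectors $\ell_1,\dots,\ell_{t-1}$ for a full-information algorithm, and only the losses $\ell_{1,a_1},\dots,\ell_{t-1,a_{t-1}}$ of the played actions for a bandit algorithm. Its expected (dynamic) regret is $\mathbb{E}\sum_{t=1}^T\bigl(\mu_{t,a_t}-\min_i\mu_{t,i}\bigr)$. For every constant $C\ge 1$ there is a constant $c>0$, depending only on $C$, such that for all $K\ge 2$, all $T$, and all real $V,\Lambda$ with $1/C\le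 V\le T$ and $0\le\Lambda\le CT$ the following hold. 1. For every full-information algorithm there is an environment of total drift at most $V$ and total variance at most $\Lambda$ in which the expected regret of the algorithm is at least $c\,\bigl((\Lambda VT)^{1/3}+V\bigr)$. 2. For every bandit algorithm there is an environment of total drift at most $V$ and total variance at most $\Lambda$ in which the expected regret of the algorithm is at least $c\,\bigl((\Lambda VT)^{1/3}+\sqrt{VT}\bigr)$. The algorithm may depend on $K,T,V,\Lambda$. -/

import Mathlib

open MeasureTheory

namespace DynamicRegret

/-- A non-stationary stochastic environment with `K` actions and `T` steps. The loss of action `i`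
at step `t` is drawn, independently over all steps and actions, from the law `law t i`, a
probability distribution on `[0, 1]`. Step `t` of the usual `1, …, T` has index `t - 1`. -/
structure Environment (K T : ℕ) where
  law : Fin T → Fin K → Measure ℝ
  isProb : ∀ t i, IsProbabilityMeasure (law t i)
  mem_Icc : ∀ t i, ∀ᵐ x ∂(law t i), x ∈ Set.Icc (0 : ℝ) 1

attribute [instance] Environment.isProb

namespace Environment

variable {K T : ℕ}

/-- The joint law of the loss vector of step `t`. -/
noncomputable def stepLaw (E : Environment K T) (t : Fin T) : Measure (Fin K → ℝ) :=
  Measure.pi (E.law t)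

instance (E : Environment K T) (t : Fin T) : IsProbabilityMeasure (E.stepLaw t) := by
  unfold stepLaw; infer_instance

/-- The joint law of the sequence of all `T` loss vectors. -/
noncomputable def lossLaw (E : Environment K T) : Measure (Fin T → Fin K → ℝ) :=
  Measure.pi E.stepLaw

instance (E : Environment K T) : IsProbabilityMeasure E.lossLaw := by
  unfold lossLaw; infer_instance

/-- The vector of expected losses of step `t`. -/
noncomputable def mean (E : Environment K T) (t : Fin T) : Fin K → ℝ :=
  fun i => ∫ x, x ∂(E.law t i)

/-- The vector of expected losses of the step before `t`, which is the zero vector if `t` is the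
first step. -/
noncomputable def prevMean (E : Environment K T) (t : Fin T) : Fin K → ℝ :=
  if 0 < t.val then E.mean ⟨t.val - 1, lt_of_le_of_lt (Nat.sub_le _ _) t.isLt⟩ else 0

/-- The expected loss of the best action at step `t`. -/
noncomputable def bestMean (E : Environment K T) (t : Fin T) : ℝ :=
  ⨅ i, E.mean t i

/-- The total drift `∑ₜ ‖μₜ - μₜ₋₁‖_∞`, with `μ₀ = 0`
(the norm of `Fin K → ℝ` is the maximum norm). -/
noncomputable def drift (E : Environment K T) : ℝ :=
  ∑ t, ‖E.mean t - E.prevMean t‖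

/-- The total variance `∑ₜ 𝔼 ‖ℓₜ - μₜ‖₂²`. -/
noncomputable def totalVariance (E : Environment K T) : ℝ :=
  ∑ t, ∫ l, ∑ i, (l i - E.mean t i) ^ 2 ∂(E.stepLaw t)

/-- The expected dynamic pseudo-regret `𝔼 ∑ₜ (μ_{t, aₜ} - minᵢ μ_{t, i})`, where the action `aₜ`
played at step `t` is given as a function of a random seed of law `ρ`, which is independent of the
losses, and of the losses. -/
noncomputable def expectedRegret (E : Environment K T) {Ω : Type*} [MeasurableSpace Ω]
    (ρ : Measure Ω) (a : Ω → (Fin T → Fin K → ℝ) → Fin T → Fin K) : ℝ :=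
  ∫ p : Ω × (Fin T → Fin K → ℝ), ∑ t, (E.mean t (a p.1 p.2 t) - E.bestMean t) ∂(ρ.prod E.lossLaw)

end Environment

/-- A (randomized) full-information algorithm with random seed in `Ω`: the action of step `t` is a
measurable function of the seed and of the full loss vectors of the earlier steps. -/
structure FullInfoAlgorithm (Ω : Type*) [MeasurableSpace Ω] (K T : ℕ) where
  act : (t : Fin T) → Ω × (Fin t.val → Fin K → ℝ) → Fin K
  measurable_act : ∀ t, Measurable (act t)

/-- The action played at step `t` for the seed `ω` and the sequence `l` of loss vectors. -/
def FullInfoAlgorithm.play {Ω : Type*} [MeasurableSpace Ω] {K T : ℕ}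
    (A : FullInfoAlgorithm Ω K T) (ω : Ω) (l : Fin T → Fin K → ℝ) (t : Fin T) : Fin K :=
  A.act t (ω, fun s => l (s.castLT (s.isLt.trans t.isLt)))

/-- A (randomized) bandit algorithm with random seed in `Ω`: the action of step `t` is a measurable
function of the seed and of the losses of the actions played in the earlier steps (these actions
are themselves determined by the seed and the losses revealed before). -/
structure BanditAlgorithm (Ω : Type*) [MeasurableSpace Ω] (K T : ℕ) where
  act : (t : Fin T) → Ω × (Fin t.val → ℝ) → Fin K
  measurable_act : ∀ t, Measurable (act t)

/-- The action played at step `t` for the seed `ω` and the sequence `l` of loss vectors: only the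
loss `l s (play s)` is revealed at an earlier step `s`. -/
def BanditAlgorithm.play {Ω : Type*} [MeasurableSpace Ω] {K T : ℕ}
    (A : BanditAlgorithm Ω K T) (ω : Ω) (l : Fin T → Fin K → ℝ) (t : Fin T) : Fin K :=
  A.act t (ω, fun s : Fin t.val =>
    l (s.castLT (s.isLt.trans t.isLt)) (A.play ω l (s.castLT (s.isLt.trans t.isLt))))
termination_by t.val
decreasing_by exact s.isLt

end DynamicRegret

namespace DynamicRegret

/-! Each bound comes from a finite family of environments whose average regret is large for every
fixed seed; integrating over the seed then yields a bad member (`exists_le_expectedRegret`). Only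
action `0` is uncertain and all others have constant loss `m`, so `K` plays no role.

Noisy blocks. In each block of length `L`, action `0` has losses `m ± σ` and mean `m ± ε`, where `ε
= σγ` and the sign is fixed per block. Earlier steps of a block provide fewer than `L` useful
samples. When `(L - 1)γ² ≤ 1/2`, the two possible signs have squared affinity at least `1/2`, so the
learner errs with constant probability and loses order `Tε` (`card_mul_le_sum_detRegret_noisyEnv`).
The variance is at most `Tσ²`, and the drift is of order `m + ε(T/L + 1)`. Taking `σ² ~ Λ/T` and `L
~ εT/V` leaves `ε³ ~ ΛV/T²`, hence regret `(ΛVT)^{1/3}`. With `L = γ = 1` the losses are noise-free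
but each new sign is unpredictable, which gives regret of order `V`.

Hidden windows, for bandits. All losses are deterministic. About `V` blocks are cut into `s ~
√(T/V)` segments of length `s`; action `0` is worse by `δ`, except that it may be better by `δ` in
one hidden segment per block. Exploring every segment costs order `sδ` per block, and so does
missing the window (`le_sum_windowRegret`). The total is of order `Vs ~ √(VT)`.

In each regime one of these terms dominates the required sum. -/

/-- Averaging over one coordinate before averaging over all of them changes nothing. -/
theorem card_mul_le_sum_of_update {ι γ : Type*} [Fintype ι] [DecidableEq ι] [Fintype γ]
    [Nonempty γ] (F : (ι → γ) → ℝ) (b : ι) (R : ℝ)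
    (h : ∀ θ, (Fintype.card γ : ℝ) * R ≤ ∑ c, F (Function.update θ b c)) :
    (Fintype.card (ι → γ) : ℝ) * R ≤ ∑ θ, F θ := by
  -- Exchanging the stored coordinate with the fresh value permutes all pairs, so resampling that
  -- coordinate preserves the uniform average.
  have hinv : Function.Involutive
      (fun q : (ι → γ) × γ => (Function.update q.1 b q.2, q.1 b)) := by
    rintro ⟨θ, c⟩
    simp
  have hswap : ∑ q : (ι → γ) × γ, F (Function.update q.1 b q.2) = ∑ q : (ι → γ) × γ, F q.1 :=
    hinv.bijective.sum_comp (fun q : (ι → γ) × γ => F q.1)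
  rw [Fintype.sum_prod_type, Fintype.sum_prod_type] at hswap
  simp only [Finset.sum_const, Finset.card_univ, nsmul_eq_mul] at hswap
  rw [← Finset.mul_sum] at hswap
  have h1 : ∑ _θ : ι → γ, (Fintype.card γ : ℝ) * R ≤ ∑ θ, ∑ c, F (Function.update θ b c) :=
    Finset.sum_le_sum fun θ _ => h θ
  rw [hswap, Finset.sum_const, Finset.card_univ, nsmul_eq_mul] at h1
  have hpos : (0 : ℝ) < Fintype.card γ := by exact_mod_cast Fintype.card_pos
  refine le_of_mul_le_mul_left ?_ hpos
  linarith

/-! ### Testing between two product distributions on Boolean sequences. -/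

section Testing

variable {ι : Type*} [Fintype ι] [DecidableEq ι]

/-- The total mass of a product of probability weights is one. -/
theorem sum_prod_weights_eq_one {p : ι → Bool → ℝ} (hp1 : ∀ s, ∑ b, p s b = 1) :
    ∑ x : ι → Bool, ∏ s, p s (x s) = 1 := by
  rw [← Fintype.prod_sum]
  exact Finset.prod_eq_one fun s _ => hp1 s

/-- The expectation of a function of the coordinates in `S` does not depend on the weights of the
other coordinates. -/
theorem sum_prod_weights_congr {p q : ι → Bool → ℝ} (hp1 : ∀ s, ∑ b, p s b = 1)
    (hq1 : ∀ s, ∑ b, q s b = 1) (S : ι → Prop) [DecidablePred S] (hpq : ∀ s, S s → p s = q s)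
    (f : (ι → Bool) → ℝ) (hf : ∀ x y, (∀ s, S s → x s = y s) → f x = f y) :
    ∑ x : ι → Bool, (∏ s, p s (x s)) * f x = ∑ x : ι → Bool, (∏ s, q s (x s)) * f x := by
  have key : ∀ r : ι → Bool → ℝ, (∀ s, ∑ b, r s b = 1) →
      ∑ x : ι → Bool, (∏ s, r s (x s)) * f x = ∑ y : {s // S s} → Bool,
        (∏ s : {s // S s}, r s (y s)) * f (fun s => if h : S s then y ⟨s, h⟩ else true) := by
    intro r hr
    rw [← (Equiv.piEquivPiSubtypeProd S (fun _ => Bool)).symm.sum_comp, Fintype.sum_prod_type]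
    refine Finset.sum_congr rfl fun y _ => ?_
    have hz : ∀ z : {s // ¬ S s} → Bool,
        (∏ s, r s ((Equiv.piEquivPiSubtypeProd S (fun _ => Bool)).symm (y, z) s)) *
          f ((Equiv.piEquivPiSubtypeProd S (fun _ => Bool)).symm (y, z)) =
        ((∏ s : {s // S s}, r s (y s)) * f (fun s => if h : S s then y ⟨s, h⟩ else true)) *
          ∏ s : {s // ¬ S s}, r s (z s) := by
      intro z
      rw [← Fintype.prod_subtype_mul_prod_subtype S,
        hf _ (fun s => if h : S s then y ⟨s, h⟩ else true)]
      · have e1 : ∀ s : {s // S s},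
            (Equiv.piEquivPiSubtypeProd S (fun _ => Bool)).symm (y, z) s = y s := by
          rintro ⟨s, hs⟩
          simp [Equiv.piEquivPiSubtypeProd, hs]
        have e2 : ∀ s : {s // ¬ S s},
            (Equiv.piEquivPiSubtypeProd S (fun _ => Bool)).symm (y, z) s = z s := by
          rintro ⟨s, hs⟩
          simp [Equiv.piEquivPiSubtypeProd, hs]
        simp only [e1, e2]
        ring
      · intro s hs
        simp [Equiv.piEquivPiSubtypeProd, hs]
    rw [Finset.sum_congr rfl fun z _ => hz z, ← Finset.mul_sum,
      sum_prod_weights_eq_one (p := fun s : {s // ¬ S s} => r s) fun s => hr s, mul_one]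
  rw [key p hp1, key q hq1]
  refine Finset.sum_congr rfl fun y _ => ?_
  congr 1
  exact Finset.prod_congr rfl fun s _ => by rw [hpq s s.2]

/-- The two errors of a test between two product distributions add up to at least half of the
squared Bhattacharyya affinity. -/
theorem half_affinity_sq_le_errors {p q : ι → Bool → ℝ} (hp : ∀ s b, 0 ≤ p s b)
    (hq : ∀ s b, 0 ≤ q s b) (hp1 : ∀ s, ∑ b, p s b = 1) (hq1 : ∀ s, ∑ b, q s b = 1)
    (f : (ι → Bool) → ℝ) (hf0 : ∀ x, 0 ≤ f x) (hf1 : ∀ x, f x ≤ 1) :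
    (∏ s, (∑ b, √(p s b * q s b)) ^ 2) / 2 ≤
      ∑ x : ι → Bool, (∏ s, p s (x s)) * f x + ∑ x : ι → Bool, (∏ s, q s (x s)) * (1 - f x) := by
  set P : (ι → Bool) → ℝ := fun x => ∏ s, p s (x s) with hP
  set Q : (ι → Bool) → ℝ := fun x => ∏ s, q s (x s) with hQ
  have hP0 : ∀ x, 0 ≤ P x := fun x => Finset.prod_nonneg fun s _ => hp s _
  have hQ0 : ∀ x, 0 ≤ Q x := fun x => Finset.prod_nonneg fun s _ => hq s _
  -- Le Cam's argument: the errors dominate `∑ min(P, Q)`, and Cauchy–Schwarz applied to `√(PQ) =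
  -- √min · √max` bounds this sum below by half the squared affinity, since `∑ max(P, Q) ≤ 2`.
  have hmin : ∑ x, min (P x) (Q x) ≤ ∑ x, P x * f x + ∑ x, Q x * (1 - f x) := by
    rw [← Finset.sum_add_distrib]
    refine Finset.sum_le_sum fun x _ => ?_
    nlinarith [mul_le_mul_of_nonneg_right (min_le_left (P x) (Q x)) (hf0 x),
      mul_le_mul_of_nonneg_right (min_le_right (P x) (Q x)) (sub_nonneg.2 (hf1 x))]
  have hmax : ∑ x, max (P x) (Q x) ≤ 2 := by
    calc ∑ x, max (P x) (Q x) ≤ ∑ x, (P x + Q x) :=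
          Finset.sum_le_sum fun x _ => max_le_add_of_nonneg (hP0 x) (hQ0 x)
      _ = 2 := by
          rw [Finset.sum_add_distrib, sum_prod_weights_eq_one hp1, sum_prod_weights_eq_one hq1]
          norm_num
  have haff : ∏ s, ∑ b, √(p s b * q s b) = ∑ x, √(min (P x) (Q x)) * √(max (P x) (Q x)) := by
    rw [Fintype.prod_sum]
    refine Finset.sum_congr rfl fun x _ => ?_
    rw [← Real.sqrt_mul (le_min (hP0 x) (hQ0 x)), min_mul_max, hP, hQ, ← Finset.prod_mul_distrib,
      Real.sqrt_prod _ fun s _ => mul_nonneg (hp s _) (hq s _)]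
  have hmin0 : 0 ≤ ∑ x, min (P x) (Q x) := Finset.sum_nonneg fun x _ => le_min (hP0 x) (hQ0 x)
  have hCS := Finset.sum_mul_sq_le_sq_mul_sq Finset.univ (fun x => √(min (P x) (Q x)))
    (fun x => √(max (P x) (Q x)))
  simp only [Real.sq_sqrt (le_min (hP0 _) (hQ0 _)),
    Real.sq_sqrt ((hP0 _).trans (le_max_left _ (Q _)))] at hCS
  rw [Finset.prod_pow, haff]
  have := mul_le_mul_of_nonneg_left hmax hmin0
  linarith

/-- The errors of a test that sees only the coordinates in `S`. -/
theorem half_affinity_sq_le_errors_of_dependsOn {p q : ι → Bool → ℝ} (hp : ∀ s b, 0 ≤ p s b)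
    (hq : ∀ s b, 0 ≤ q s b) (hp1 : ∀ s, ∑ b, p s b = 1) (hq1 : ∀ s, ∑ b, q s b = 1)
    (S : ι → Prop) [DecidablePred S]
    (f : (ι → Bool) → ℝ) (hf0 : ∀ x, 0 ≤ f x) (hf1 : ∀ x, f x ≤ 1)
    (hf : ∀ x y, (∀ s, S s → x s = y s) → f x = f y) :
    (∏ s, if S s then (∑ b, √(p s b * q s b)) ^ 2 else 1) / 2 ≤
      ∑ x : ι → Bool, (∏ s, p s (x s)) * f x + ∑ x : ι → Bool, (∏ s, q s (x s)) * (1 - f x) := by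
  -- Replacing `q` by `p` at the unseen coordinates leaves the test's errors unchanged and makes the
  -- affinity there equal to one.
  have h := half_affinity_sq_le_errors (p := p) (q := fun s => if S s then q s else p s) hp
    (fun s b => by split_ifs <;> simp [hp, hq]) hp1 (fun s => by split_ifs; exacts [hq1 s, hp1 s])
    f hf0 hf1
  rw [sum_prod_weights_congr (q := q) (fun s => by split_ifs; exacts [hq1 s, hp1 s]) hq1 S
    (fun s hs => by simp [hs]) (fun x => 1 - f x) (fun x y hxy => by rw [hf x y hxy])] at h
  refine le_trans (le_of_eq ?_) h
  congr 1
  refine Finset.prod_congr rfl fun s _ => ?_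
  split_ifs with hs
  · rfl
  · simp only [Real.sqrt_mul_self (hp s _), hp1]
    norm_num

end Testing

/-! ### Environments in which only action `0` is random. -/

/-- The Bernoulli distribution on `Bool` with success probability `p`. -/
noncomputable def coin (p : unitInterval) : Measure Bool :=
  ENNReal.ofReal p • Measure.dirac true + ENNReal.ofReal (1 - p) • Measure.dirac false

instance (p : unitInterval) : IsProbabilityMeasure (coin p) := by
  constructor
  simp only [coin, Measure.add_apply, Measure.smul_apply, measure_univ, smul_eq_mul, mul_one]
  rw [← ENNReal.ofReal_add p.2.1 (sub_nonneg.2 p.2.2)]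
  simp

/-- The probability of an outcome of the coin. -/
noncomputable def coinWeight (p : unitInterval) (b : Bool) : ℝ :=
  if b then (p : ℝ) else 1 - p

theorem coinWeight_nonneg (p : unitInterval) (b : Bool) : 0 ≤ coinWeight p b := by
  unfold coinWeight
  split_ifs
  exacts [p.2.1, sub_nonneg.2 p.2.2]

theorem sum_coinWeight (p : unitInterval) : ∑ b, coinWeight p b = 1 := by
  simp [coinWeight]

theorem coin_real_singleton (p : unitInterval) (b : Bool) : (coin p).real {b} = coinWeight p b := by
  have h0 : (0 : ℝ) ≤ p := p.2.1
  have h1 : (0 : ℝ) ≤ 1 - p := sub_nonneg.2 p.2.2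
  cases b <;> simp [coin, coinWeight, Measure.real, h0, h1]

theorem integral_coin (p : unitInterval) (f : Bool → ℝ) :
    ∫ b, f b ∂(coin p) = p * f true + (1 - p) * f false := by
  rw [integral_fintype (Integrable.of_finite)]
  simp [coin_real_singleton, coinWeight]

variable {T : ℕ}

/-- The loss vector in which action `0` has loss `x` and all other actions have loss `m`. -/
def oneLoss (K : ℕ) [NeZero K] (m x : ℝ) : Fin K → ℝ := fun i => if i = 0 then x else m

/-- The environment in which action `0` has loss `val t b` at step `t`, with `b` the outcome of a
coin of bias `p t`, and all other actions have the constant loss `m`. -/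
noncomputable def coinEnv (K : ℕ) [NeZero K] (m : ℝ) (p : Fin T → unitInterval)
    (val : Fin T → Bool → ℝ) (hm : m ∈ Set.Icc (0 : ℝ) 1)
    (hval : ∀ t b, val t b ∈ Set.Icc (0 : ℝ) 1) : Environment K T where
  law t i := (coin (p t)).map (fun b => oneLoss K m (val t b) i)
  isProb t i := Measure.isProbabilityMeasure_map (measurable_of_finite _).aemeasurable
  mem_Icc t i := by
    refine (ae_map_iff (measurable_of_finite _).aemeasurable measurableSet_Icc).2 ?_
    refine Filter.Eventually.of_forall fun b => ?_
    unfold oneLoss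
    split_ifs
    exacts [hval t b, hm]

section CoinEnv

variable {K : ℕ} [NeZero K] {m : ℝ} {p : Fin T → unitInterval} {val : Fin T → Bool → ℝ}
  {hm : m ∈ Set.Icc (0 : ℝ) 1} {hval : ∀ t b, val t b ∈ Set.Icc (0 : ℝ) 1}

/-- The mean loss of action `0` at step `t`. -/
noncomputable def coinMean (p : Fin T → unitInterval) (val : Fin T → Bool → ℝ) (t : Fin T) : ℝ :=
  p t * val t true + (1 - p t) * val t false

theorem coinEnv_mean (t : Fin T) :
    (coinEnv K m p val hm hval).mean t = oneLoss K m (coinMean p val t) := by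
  funext i
  unfold Environment.mean coinEnv
  simp only
  rw [integral_map (measurable_of_finite _).aemeasurable (by fun_prop), integral_coin]
  unfold oneLoss coinMean
  split_ifs
  · rfl
  · ring

/-- All coordinates except `0` are constant, so the product law is driven by a single coin. On a
box, either every constant lies in its side and only the factor at `0` remains, or both measures
vanish. -/
theorem coinEnv_stepLaw (t : Fin T) :
    (coinEnv K m p val hm hval).stepLaw t =
      (coin (p t)).map (fun b => oneLoss K m (val t b)) := by
  unfold Environment.stepLaw
  refine Measure.pi_eq fun s hs => ?_
  rw [Measure.map_apply (measurable_of_finite _) (MeasurableSet.univ_pi hs)]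
  have hlaw : ∀ i, (coinEnv K m p val hm hval).law t i (s i) =
      coin (p t) {b | oneLoss K m (val t b) i ∈ s i} := fun i =>
    Measure.map_apply (measurable_of_finite _) (hs i)
  simp only [hlaw]
  by_cases h : ∀ i : Fin K, i ≠ 0 → m ∈ s i
  · rw [Finset.prod_eq_single 0 _ (by simp)]
    · congr 1
      ext b
      simp only [Set.mem_preimage, Set.mem_pi, Set.mem_univ, true_imp_iff, Set.mem_ofPred_eq]
      refine ⟨fun hb => hb 0, fun hb i => ?_⟩
      by_cases hi : i = 0
      · exact hi ▸ hb
      · simpa [oneLoss, hi] using h i hi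
    · intro i _ hi
      have : {b | oneLoss K m (val t b) i ∈ s i} = Set.univ := by
        ext b
        simpa [oneLoss, hi] using h i hi
      rw [this, measure_univ]
  · push Not at h
    obtain ⟨i, hi, hmi⟩ := h
    have h0 : {b | oneLoss K m (val t b) i ∈ s i} = ∅ := by
      ext b
      simpa [oneLoss, hi] using hmi
    rw [Finset.prod_eq_zero (Finset.mem_univ i) (by rw [h0, measure_empty])]
    have : (fun b => oneLoss K m (val t b)) ⁻¹' Set.univ.pi s = ∅ := by
      ext b
      simp only [Set.mem_preimage, Set.mem_pi, Set.mem_univ, true_imp_iff, Set.mem_empty_iff_false,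
        iff_false]
      intro hb
      exact hmi (by simpa [oneLoss, hi] using hb i)
    rw [this, measure_empty]

theorem coinEnv_lossLaw :
    (coinEnv K m p val hm hval).lossLaw =
      (Measure.pi fun t => coin (p t)).map (fun x t => oneLoss K m (val t (x t))) := by
  unfold Environment.lossLaw
  have := Measure.pi_map_pi (μ := fun t => coin (p t)) (f := fun t b => oneLoss K m (val t b))
    (fun t => (measurable_of_finite _).aemeasurable)
  rw [this]
  congr 1
  funext t
  exact coinEnv_stepLaw t

theorem integral_coinEnv_lossLaw (f : (Fin T → Fin K → ℝ) → ℝ) (hf : Measurable f) :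
    ∫ l, f l ∂(coinEnv K m p val hm hval).lossLaw =
      ∑ x : Fin T → Bool, (∏ t, coinWeight (p t) (x t)) *
        f (fun t => oneLoss K m (val t (x t))) := by
  rw [coinEnv_lossLaw, integral_map (measurable_of_finite _).aemeasurable
    hf.aestronglyMeasurable, integral_fintype (Integrable.of_finite)]
  refine Finset.sum_congr rfl fun x _ => ?_
  rw [smul_eq_mul, Measure.real, Measure.pi_singleton, ENNReal.toReal_prod]
  congr 1
  exact Finset.prod_congr rfl fun t _ => coin_real_singleton (p t) (x t)

theorem coinEnv_totalVariance :
    (coinEnv K m p val hm hval).totalVariance =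
      ∑ t, (p t * (1 - p t) * (val t true - val t false) ^ 2 : ℝ) := by
  unfold Environment.totalVariance
  refine Finset.sum_congr rfl fun t _ => ?_
  rw [coinEnv_stepLaw, integral_map (measurable_of_finite _).aemeasurable
    (Measurable.aestronglyMeasurable (by fun_prop)), integral_coin, coinEnv_mean]
  have h : ∀ x y : ℝ, ∑ i : Fin K, (oneLoss K m x i - oneLoss K m y i) ^ 2 = (x - y) ^ 2 := by
    intro x y
    rw [Finset.sum_eq_single 0 (fun i _ hi => by simp [oneLoss, hi]) (by simp)]
    simp [oneLoss]
  rw [h, h, coinMean]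
  ring

/-- Action `1` exists because `2 ≤ K` and realizes the mean `m`. An upper bound on the best mean
suffices for bounding regret from below. -/
theorem coinEnv_bestMean_le (hK : 2 ≤ K) (t : Fin T) :
    (coinEnv K m p val hm hval).bestMean t ≤ min (coinMean p val t) m := by
  unfold Environment.bestMean
  rw [coinEnv_mean]
  refine le_min ?_ ?_
  · exact (ciInf_le (Set.finite_range _).bddBelow (0 : Fin K)).trans (by simp [oneLoss])
  · refine (ciInf_le (Set.finite_range _).bddBelow (⟨1, hK⟩ : Fin K)).trans (le_of_eq ?_)
    have : (⟨1, hK⟩ : Fin K) ≠ 0 := by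
      intro h
      simpa using congrArg Fin.val h
    simp [oneLoss, this]

theorem norm_oneLoss_sub_oneLoss_le (x y : ℝ) :
    ‖oneLoss K m x - oneLoss K m y‖ ≤ |x - y| := by
  rw [pi_norm_le_iff_of_nonneg (abs_nonneg _)]
  intro i
  simp only [Pi.sub_apply, oneLoss]
  split_ifs <;> simp

/-- The drift of an environment whose means are given by a sequence indexed by the naturals. -/
theorem coinEnv_drift_le (G : ℕ → ℝ) (hG : ∀ t, coinMean p val t = G t) (B : ℝ)
    (hG0 : |G 0| ≤ B) (hmB : m ≤ B) :
    (coinEnv K m p val hm hval).drift ≤ B + ∑ t ∈ Finset.range T, |G t - G (t - 1)| := by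
  have hB : 0 ≤ B := (abs_nonneg _).trans hG0
  -- At `t = 0` truncated subtraction makes the increment of `G` vanish; the jump from `μ₀ = 0` is
  -- charged to `B` instead.
  have hstep : ∀ t : Fin T, ‖(coinEnv K m p val hm hval).mean t -
      (coinEnv K m p val hm hval).prevMean t‖ ≤
      (if t.val = 0 then B else 0) + |G t - G (t - 1 : ℕ)| := by
    intro t
    unfold Environment.prevMean
    by_cases ht : t.val = 0
    · rw [if_neg (by omega), if_pos ht, sub_zero, coinEnv_mean, hG, ht]
      simp only [Nat.zero_sub, sub_self, abs_zero, add_zero]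
      rw [pi_norm_le_iff_of_nonneg hB]
      intro i
      simp only [oneLoss, Real.norm_eq_abs]
      split_ifs
      · exact hG0
      · rwa [abs_of_nonneg hm.1]
    · rw [if_pos (by omega), if_neg ht, zero_add, coinEnv_mean, coinEnv_mean, hG, hG]
      exact norm_oneLoss_sub_oneLoss_le _ _
  unfold Environment.drift
  refine (Finset.sum_le_sum fun t _ => hstep t).trans ?_
  rw [Finset.sum_add_distrib, Finset.sum_range fun t => |G t - G (t - 1)|]
  gcongr
  rcases Nat.eq_zero_or_pos T with hT | hT
  · subst hT
    simpa using hB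
  · rw [Finset.sum_eq_single (⟨0, hT⟩ : Fin T)]
    · simp
    · intro t _ ht
      rw [if_neg fun h => ht (Fin.ext h)]
    · simp

end CoinEnv

/-! ### Measurability and causality of the played actions. -/

section Play

variable {Ω : Type*} [MeasurableSpace Ω] {K T : ℕ}

theorem FullInfoAlgorithm.measurable_play (A : FullInfoAlgorithm Ω K T) (t : Fin T) :
    Measurable fun q : Ω × (Fin T → Fin K → ℝ) => A.play q.1 q.2 t := by
  unfold FullInfoAlgorithm.play
  exact (A.measurable_act t).comp (by fun_prop)

theorem FullInfoAlgorithm.play_congr (A : FullInfoAlgorithm Ω K T) (ω : Ω)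
    (l l' : Fin T → Fin K → ℝ) (t : Fin T) (h : ∀ s < t, l s = l' s) :
    A.play ω l t = A.play ω l' t := by
  unfold FullInfoAlgorithm.play
  congr 2
  funext s
  exact h _ s.isLt

theorem measurable_apply_of_finite {α ι : Type*} [MeasurableSpace α] [Finite ι]
    [MeasurableSpace ι] [MeasurableSingletonClass ι] {f : α → ι → ℝ} {i : α → ι}
    (hf : Measurable f) (hi : Measurable i) : Measurable fun x => f x (i x) := by
  have : Measurable fun q : (ι → ℝ) × ι => q.1 q.2 :=
    measurable_from_prod_countable_left fun i => measurable_pi_apply i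
  exact this.comp (hf.prodMk hi)

theorem BanditAlgorithm.measurable_play (A : BanditAlgorithm Ω K T) (t : Fin T) :
    Measurable fun q : Ω × (Fin T → Fin K → ℝ) => A.play q.1 q.2 t := by
  induction t using WellFoundedLT.induction with
  | ind t ih =>
    have : (fun q : Ω × (Fin T → Fin K → ℝ) => A.play q.1 q.2 t) = fun q =>
        A.act t (q.1, fun s : Fin t.val => q.2 (s.castLT (s.isLt.trans t.isLt))
          (A.play q.1 q.2 (s.castLT (s.isLt.trans t.isLt)))) := by
      funext q
      rw [BanditAlgorithm.play]
    rw [this]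
    refine (A.measurable_act t).comp (measurable_fst.prodMk (measurable_pi_lambda _ fun s => ?_))
    exact measurable_apply_of_finite (by fun_prop) (ih _ s.isLt)

/-- By strong induction the two runs play the same actions, so it is enough to compare losses along
the actions played under `l`. -/
theorem BanditAlgorithm.play_congr (A : BanditAlgorithm Ω K T) (ω : Ω)
    (l l' : Fin T → Fin K → ℝ) (t : Fin T)
    (h : ∀ s < t, l s (A.play ω l s) = l' s (A.play ω l s)) :
    A.play ω l t = A.play ω l' t := by
  induction t using WellFoundedLT.induction with
  | ind t ih =>
    rw [BanditAlgorithm.play, BanditAlgorithm.play]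
    congr 2
    funext s
    rw [← ih _ s.isLt fun r hr => h r (hr.trans s.isLt)]
    exact h _ s.isLt

end Play

/-! ### Reduction to deterministic learners and finite families. -/

section Averaging

variable {K T : ℕ}

/-- The expected regret of a learner without internal randomness. -/
noncomputable def Environment.detRegret (E : Environment K T)
    (a : (Fin T → Fin K → ℝ) → Fin T → Fin K) : ℝ :=
  ∫ l, ∑ t, (E.mean t (a l t) - E.bestMean t) ∂E.lossLaw

/-- If, for each seed, the average regret over a finite family of environments is at least `R`,
then so is the expected regret in some environment of the family. -/
theorem exists_le_expectedRegret {Ω : Type*} [MeasurableSpace Ω] (ρ : Measure Ω)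
    [IsProbabilityMeasure ρ] {Θ : Type*} [Fintype Θ] [Nonempty Θ] (E : Θ → Environment K T)
    (a : Ω → (Fin T → Fin K → ℝ) → Fin T → Fin K)
    (ha : ∀ t, Measurable fun q : Ω × (Fin T → Fin K → ℝ) => a q.1 q.2 t) (R : ℝ)
    (h : ∀ ω, (Fintype.card Θ : ℝ) * R ≤ ∑ θ, (E θ).detRegret (a ω)) :
    ∃ θ, R ≤ (E θ).expectedRegret ρ a := by
  have hint : ∀ θ, Integrable (fun q : Ω × (Fin T → Fin K → ℝ) =>
      ∑ t, ((E θ).mean t (a q.1 q.2 t) - (E θ).bestMean t)) (ρ.prod (E θ).lossLaw) := by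
    intro θ
    refine integrable_finsetSum _ fun t _ => ?_
    have hmeas : Measurable fun q : Ω × (Fin T → Fin K → ℝ) =>
        (E θ).mean t (a q.1 q.2 t) - (E θ).bestMean t :=
      (measurable_of_finite fun i => (E θ).mean t i - (E θ).bestMean t).comp (ha t)
    refine Integrable.of_bound hmeas.aestronglyMeasurable
      (∑ i, ‖(E θ).mean t i - (E θ).bestMean t‖) (Filter.Eventually.of_forall fun q => ?_)
    exact Finset.single_le_sum (f := fun i => ‖(E θ).mean t i - (E θ).bestMean t‖)
      (fun i _ => norm_nonneg _) (Finset.mem_univ (a q.1 q.2 t))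
  have hfub : ∀ θ, (E θ).expectedRegret ρ a = ∫ ω, (E θ).detRegret (a ω) ∂ρ := fun θ =>
    integral_prod _ (hint θ)
  have hint' : ∀ θ, Integrable (fun ω => (E θ).detRegret (a ω)) ρ := fun θ =>
    (hint θ).integral_prod_left
  by_contra! hlt
  have h1 : ∑ θ, (E θ).expectedRegret ρ a < ∑ _θ : Θ, R :=
    Finset.sum_lt_sum_of_nonempty Finset.univ_nonempty fun θ _ => hlt θ
  have h2 : (Fintype.card Θ : ℝ) * R ≤ ∑ θ, (E θ).expectedRegret ρ a := by
    simp only [hfub]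
    rw [← integral_finsetSum _ fun θ _ => hint' θ]
    calc (Fintype.card Θ : ℝ) * R = ∫ _ω, (Fintype.card Θ : ℝ) * R ∂ρ := by simp
      _ ≤ _ := integral_mono (integrable_const _) (integrable_finsetSum _ fun θ _ => hint' θ) h
  rw [Finset.sum_const, Finset.card_univ, nsmul_eq_mul] at h1
  linarith

variable [NeZero K] {m : ℝ} {p : Fin T → unitInterval} {val : Fin T → Bool → ℝ}
  {hm : m ∈ Set.Icc (0 : ℝ) 1} {hval : ∀ t b, val t b ∈ Set.Icc (0 : ℝ) 1}

/-- The instantaneous regret when action `0` has mean `g`, all other actions have mean `m`, and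
`i` is played. -/
def gapRegret (m g : ℝ) (i : Fin K) : ℝ := if i = 0 then max (g - m) 0 else max (m - g) 0

theorem gapRegret_nonneg (m g : ℝ) (i : Fin K) : 0 ≤ gapRegret m g i := by
  unfold gapRegret
  split_ifs <;> exact le_max_right _ _

theorem le_detRegret_coinEnv (hK : 2 ≤ K) (a : (Fin T → Fin K → ℝ) → Fin T → Fin K)
    (ha : ∀ t, Measurable fun l => a l t) :
    ∑ t, ∑ x : Fin T → Bool, (∏ s, coinWeight (p s) (x s)) *
        gapRegret m (coinMean p val t) (a (fun s => oneLoss K m (val s (x s))) t) ≤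
      (coinEnv K m p val hm hval).detRegret a := by
  have hmeas : Measurable fun l => ∑ t, ((coinEnv K m p val hm hval).mean t (a l t) -
      (coinEnv K m p val hm hval).bestMean t) :=
    Finset.measurable_sum _ fun t _ =>
      (measurable_of_finite fun i => (coinEnv K m p val hm hval).mean t i -
        (coinEnv K m p val hm hval).bestMean t).comp (ha t)
  unfold Environment.detRegret
  rw [integral_coinEnv_lossLaw _ hmeas, Finset.sum_comm]
  refine Finset.sum_le_sum fun x _ => ?_
  rw [← Finset.mul_sum]
  refine mul_le_mul_of_nonneg_left (Finset.sum_le_sum fun t _ => ?_)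
    (Finset.prod_nonneg fun s _ => coinWeight_nonneg _ _)
  have h := coinEnv_bestMean_le (p := p) (val := val) (hm := hm) (hval := hval) hK t
  have h1 := h.trans (min_le_left _ _)
  have h2 := h.trans (min_le_right _ _)
  rw [coinEnv_mean]
  unfold gapRegret oneLoss
  split_ifs
  · exact max_le (by linarith) (by linarith)
  · exact max_le (by linarith) (by linarith)

end Averaging

/-! ### The noisy block environments. -/

section Noisy

/-- The sign `1` of `true` and `-1` of `false`. -/
def boolSign (b : Bool) : ℝ := if b then 1 else -1

theorem abs_boolSign (b : Bool) : |boolSign b| = 1 := by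
  cases b <;> simp [boolSign]

/-- The index of the block of length `L` that contains step `t`. -/
def blockIndex (T L t : ℕ) : Fin (T / L + 1) := Fin.ofNat (T / L + 1) (t / L)

/-- The wrap-around in `Fin.ofNat` never occurs for actual steps; the extra index accommodates a
partial last block. -/
theorem blockIndex_val {T L t : ℕ} (ht : t < T) : (blockIndex T L t).val = t / L := by
  have : t / L ≤ T / L := Nat.div_le_div_right ht.le
  simp only [blockIndex, Fin.ofNat]
  exact Nat.mod_eq_of_lt (by omega)

/-- The probability `(1 ± γ) / 2`, with the sign chosen by a Boolean. -/
noncomputable def biasedProb (γ : ℝ) (hγ : γ ∈ Set.Icc (0 : ℝ) 1) (b : Bool) : unitInterval :=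
  ⟨(1 + boolSign b * γ) / 2, by
    have := hγ.1
    have := hγ.2
    unfold boolSign
    split_ifs <;> constructor <;> linarith⟩

/-- For opposite signs, each outcome has product of weights `(1 + γ)(1 - γ)/4`, so the affinity is
`√(1 - γ²)`. -/
theorem affinity_biasedProb_sq {γ : ℝ} (hγ : γ ∈ Set.Icc (0 : ℝ) 1) (c d : Bool) :
    (∑ b, √(coinWeight (biasedProb γ hγ c) b * coinWeight (biasedProb γ hγ d) b)) ^ 2 =
      if c = d then 1 else 1 - γ ^ 2 := by
  have hγ2 : 0 ≤ 1 - γ ^ 2 := by nlinarith [hγ.1, hγ.2]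
  split_ifs with h
  · subst h
    simp only [Real.sqrt_mul_self (coinWeight_nonneg _ _), sum_coinWeight, one_pow]
  · have key : ∀ b, coinWeight (biasedProb γ hγ c) b * coinWeight (biasedProb γ hγ d) b =
        (1 - γ ^ 2) / 4 := by
      intro b
      cases b <;> cases c <;> cases d <;> simp_all [coinWeight, biasedProb, boolSign] <;> ring
    simp only [key, Fintype.sum_bool]
    have := Real.mul_self_sqrt (show 0 ≤ (1 - γ ^ 2) / 4 by linarith)
    linear_combination 4 * this

theorem card_filter_dvd_range_le (T L : ℕ) :
    ((Finset.range T).filter (L ∣ ·)).card ≤ T / L + 1 := by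
  rw [← Finset.card_range (T / L + 1)]
  refine Finset.card_le_card_of_injOn (· / L) ?_ ?_
  · intro t ht
    simp only [Finset.coe_filter, Finset.mem_range, Set.mem_ofPred_eq] at ht
    have : t / L ≤ T / L := Nat.div_le_div_right ht.1.le
    simp only [Finset.coe_range, Set.mem_Iio]
    omega
  · intro t ht s hs hts
    simp only [Finset.coe_filter, Finset.mem_range, Set.mem_ofPred_eq] at ht hs
    rw [← Nat.div_mul_cancel ht.2, ← Nat.div_mul_cancel hs.2]
    exact congrArg (· * L) hts

variable {K T : ℕ} [NeZero K]

/-- Blocks of length `L` in each of which the mean of action `0` lies `σ γ` above or below that of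
the other actions, as told by `θ`. -/
noncomputable def noisyEnv (K T L : ℕ) [NeZero K] (m σ γ : ℝ) (hγ : γ ∈ Set.Icc (0 : ℝ) 1)
    (hσ : 0 ≤ σ) (hσm : σ ≤ m) (hm : m ≤ 1 / 2) (θ : Fin (T / L + 1) → Bool) : Environment K T :=
  coinEnv K m (fun t => biasedProb γ hγ (θ (blockIndex T L t))) (fun _ b => m + boolSign b * σ)
    ⟨hσ.trans hσm, by linarith⟩ fun t b => by
      unfold boolSign
      split_ifs <;> constructor <;> linarith

variable {L : ℕ} {m σ γ : ℝ} {hγ : γ ∈ Set.Icc (0 : ℝ) 1} {hσ : 0 ≤ σ} {hσm : σ ≤ m}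
  {hm : m ≤ 1 / 2}

theorem noisyEnv_coinMean (θ : Fin (T / L + 1) → Bool) (t : Fin T) :
    coinMean (fun t => biasedProb γ hγ (θ (blockIndex T L t))) (fun _ b => m + boolSign b * σ) t =
      m + boolSign (θ (blockIndex T L t)) * (σ * γ) := by
  simp only [coinMean, biasedProb]
  simp only [boolSign, if_true, Bool.false_eq_true, if_false]
  ring

/-- The mean can change only at multiples of `L`, by at most `2σγ`; the initial jump from zero costs
at most `2m`. -/
theorem noisyEnv_drift_le (θ : Fin (T / L + 1) → Bool) :
    (noisyEnv K T L m σ γ hγ hσ hσm hm θ).drift ≤ 2 * m + 2 * (σ * γ) * ((T / L : ℕ) + 1) := by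
  have hε : 0 ≤ σ * γ := mul_nonneg hσ hγ.1
  have hεm : σ * γ ≤ m := (mul_le_of_le_one_right hσ hγ.2).trans hσm
  set G : ℕ → ℝ := fun t => m + boolSign (θ (blockIndex T L t)) * (σ * γ) with hG
  refine (coinEnv_drift_le G (noisyEnv_coinMean θ) (2 * m) ?_ (by linarith)).trans ?_
  · rw [hG, abs_le]
    have h1 := abs_le.1 (abs_boolSign (θ (blockIndex T L 0))).le
    constructor <;> nlinarith
  · have hstep : ∀ t ∈ Finset.range T, |G t - G (t - 1)| ≤ if L ∣ t then 2 * (σ * γ) else 0 := by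
      intro t ht
      split_ifs with hd
      · have : G t - G (t - 1) = (boolSign (θ (blockIndex T L t)) -
            boolSign (θ (blockIndex T L (t - 1)))) * (σ * γ) := by
          rw [hG]
          ring
        rw [this, abs_mul, abs_of_nonneg hε]
        refine mul_le_mul_of_nonneg_right ((abs_sub _ _).trans ?_) hε
        rw [abs_boolSign, abs_boolSign]
        norm_num
      · have h0 : t ≠ 0 := fun h => hd (h ▸ dvd_zero L)
        have : t / L = (t - 1) / L := by
          obtain ⟨n, rfl⟩ := Nat.exists_eq_succ_of_ne_zero h0
          rw [Nat.succ_div_of_not_dvd hd]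
          rfl
        simp [hG, blockIndex, this]
    refine add_le_add_right ((Finset.sum_le_sum hstep).trans ?_) _
    rw [← Finset.sum_filter, Finset.sum_const, nsmul_eq_mul, mul_comm]
    refine mul_le_mul_of_nonneg_left ?_ (by linarith)
    exact_mod_cast card_filter_dvd_range_le T L

theorem noisyEnv_totalVariance (θ : Fin (T / L + 1) → Bool) :
    (noisyEnv K T L m σ γ hγ hσ hσm hm θ).totalVariance = T * ((1 - γ ^ 2) * σ ^ 2) := by
  refine coinEnv_totalVariance.trans ?_
  have : ∀ t : Fin T, ((biasedProb γ hγ (θ (blockIndex T L t)) : ℝ) *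
      (1 - (biasedProb γ hγ (θ (blockIndex T L t)) : ℝ)) *
      (m + boolSign true * σ - (m + boolSign false * σ)) ^ 2) = (1 - γ ^ 2) * σ ^ 2 := by
    intro t
    simp only [biasedProb, boolSign]
    split_ifs <;> simp_all <;> ring
  simp only [this]
  simp

/-- The affinity between two sign choices that differ in the block of `t`, for an observer of the
steps before `t`. -/
theorem half_le_affinity_noisy (hL : 1 ≤ L) (hγL : ((L : ℝ) - 1) * γ ^ 2 ≤ 1 / 2)
    (θ : Fin (T / L + 1) → Bool) (t : Fin T) :
    1 / 2 ≤ ∏ s : Fin T, if s < t then (∑ b, √(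
      coinWeight (biasedProb γ hγ
        (Function.update θ (blockIndex T L t) true (blockIndex T L s))) b *
      coinWeight (biasedProb γ hγ
        (Function.update θ (blockIndex T L t) false (blockIndex T L s))) b)) ^ 2 else 1 := by
  have hγ0 : 0 ≤ 1 - γ ^ 2 := by nlinarith [hγ.1, hγ.2]
  have hterm : ∀ s : Fin T, (if s < t then (∑ b, √(
      coinWeight (biasedProb γ hγ
        (Function.update θ (blockIndex T L t) true (blockIndex T L s))) b *
      coinWeight (biasedProb γ hγ
        (Function.update θ (blockIndex T L t) false (blockIndex T L s))) b)) ^ 2 else 1) =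
      if s < t ∧ s.val / L = t.val / L then 1 - γ ^ 2 else 1 := by
    intro s
    have hiff : blockIndex T L s = blockIndex T L t ↔ s.val / L = t.val / L := by
      rw [Fin.ext_iff, blockIndex_val s.isLt, blockIndex_val t.isLt]
    rw [affinity_biasedProb_sq]
    by_cases hst : s < t <;> by_cases hb : s.val / L = t.val / L
    · simp [hst, hb, hiff.2 hb]
    · simp [hst, hb, Function.update_of_ne (fun h => hb (hiff.1 h))]
    · simp [hst]
    · simp [hst]
  rw [Finset.prod_congr rfl fun s _ => hterm s, ← Finset.prod_filter, Finset.prod_const]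
  -- Only earlier steps of the same block distinguish the two signs, and there are at most `L - 1`
  -- of them. Bernoulli's inequality then bounds the power of `1 - γ²`.
  have hcard : (Finset.univ.filter fun s : Fin T => s < t ∧ s.val / L = t.val / L).card ≤
      L - 1 := by
    have h1 : (Finset.univ.filter fun s : Fin T => s < t ∧ s.val / L = t.val / L).card ≤
        (Finset.Ico (t.val / L * L) t.val).card := by
      refine Finset.card_le_card_of_injOn Fin.val ?_ (Fin.val_injective.injOn)
      intro s hs
      simp only [Finset.coe_filter, Finset.mem_univ, true_and, Set.mem_ofPred_eq] at hs
      simp only [Finset.coe_Ico, Set.mem_Ico]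
      exact ⟨hs.2 ▸ Nat.div_mul_le_self s.val L, hs.1⟩
    rw [Nat.card_Ico] at h1
    have h2 := Nat.div_add_mod' t.val L
    have h3 := Nat.mod_lt t.val hL
    omega
  calc (1 / 2 : ℝ) ≤ 1 + ((L - 1 : ℕ) : ℝ) * (-γ ^ 2) := by
        rw [Nat.cast_sub hL]
        push_cast
        linarith
    _ ≤ (1 + -γ ^ 2) ^ (L - 1) := one_add_mul_le_pow (by linarith) _
    _ = (1 - γ ^ 2) ^ (L - 1) := by ring
    _ ≤ _ := pow_le_pow_of_le_one hγ0 (by nlinarith [sq_nonneg γ]) hcard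

/-- At each step, fix the signs of the other blocks and regard playing action `0` as a test for the
current sign. The regrets under the two signs are `σγ` times the two errors, whose sum is at least
`1/4`; averaging gives `σγ/8` per step. -/
theorem card_mul_le_sum_detRegret_noisyEnv (hK : 2 ≤ K) (hL : 1 ≤ L)
    (hγL : ((L : ℝ) - 1) * γ ^ 2 ≤ 1 / 2) (a : (Fin T → Fin K → ℝ) → Fin T → Fin K)
    (ha : ∀ t, Measurable fun l => a l t)
    (hna : ∀ l l' t, (∀ s < t, l s = l' s) → a l t = a l' t) :
    (Fintype.card (Fin (T / L + 1) → Bool) : ℝ) * (T * (σ * γ) / 8) ≤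
      ∑ θ, (noisyEnv K T L m σ γ hγ hσ hσm hm θ).detRegret a := by
  have hε : 0 ≤ σ * γ := mul_nonneg hσ hγ.1
  refine le_trans ?_ (Finset.sum_le_sum fun θ _ => le_detRegret_coinEnv hK a ha)
  rw [Finset.sum_comm]
  have hT : (Fintype.card (Fin (T / L + 1) → Bool) : ℝ) * (T * (σ * γ) / 8) =
      ∑ _t : Fin T, (Fintype.card (Fin (T / L + 1) → Bool) : ℝ) * (σ * γ / 8) := by
    rw [Finset.sum_const, Finset.card_univ, Fintype.card_fin, nsmul_eq_mul]
    ring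
  rw [hT]
  refine Finset.sum_le_sum fun t _ => ?_
  refine card_mul_le_sum_of_update _ (blockIndex T L t) _ fun θ => ?_
  simp only [noisyEnv_coinMean, Function.update_self, Fintype.sum_bool, Fintype.card_bool]
  set l : (Fin T → Bool) → Fin T → Fin K → ℝ :=
    fun x s => oneLoss K m (m + boolSign (x s) * σ) with hl
  set f : (Fin T → Bool) → ℝ := fun x => if a (l x) t = 0 then 1 else 0 with hf
  have htrue : ∀ x, gapRegret m (m + boolSign true * (σ * γ)) (a (l x) t) = (σ * γ) * f x := by
    intro x
    simp only [gapRegret, boolSign, hf]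
    split_ifs <;> simp_all
  have hfalse : ∀ x, gapRegret m (m + boolSign false * (σ * γ)) (a (l x) t) =
      (σ * γ) * (1 - f x) := by
    intro x
    simp only [gapRegret, boolSign, hf]
    split_ifs <;> simp_all
  have htest := half_affinity_sq_le_errors_of_dependsOn
    (p := fun s : Fin T => coinWeight (biasedProb γ hγ
      (Function.update θ (blockIndex T L t) true (blockIndex T L s))))
    (q := fun s : Fin T => coinWeight (biasedProb γ hγ
      (Function.update θ (blockIndex T L t) false (blockIndex T L s))))
    (fun s => coinWeight_nonneg _) (fun s => coinWeight_nonneg _) (fun s => sum_coinWeight _)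
    (fun s => sum_coinWeight _) (fun s => s < t) f
    (fun x => by simp only [hf]; split_ifs <;> norm_num)
    (fun x => by simp only [hf]; split_ifs <;> norm_num)
    (fun x y hxy => by
      simp only [hf]
      rw [hna (l x) (l y) t fun s hs => by simp only [hl, hxy s hs]])
  have haff := half_le_affinity_noisy (hγ := hγ) hL hγL θ t
  have h4 := mul_le_mul_of_nonneg_left ((div_le_div_of_nonneg_right haff zero_le_two).trans htest)
    hε
  simp only [hl] at htrue hfalse
  simp only [htrue, hfalse, mul_left_comm _ (σ * γ), ← Finset.mul_sum, ← mul_add]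
  refine le_trans (le_of_eq ?_) h4
  push_cast
  ring

theorem exists_noisyEnv_le_expectedRegret (hK : 2 ≤ K) (hL : 1 ≤ L)
    (hγ : γ ∈ Set.Icc (0 : ℝ) 1) (hσ : 0 ≤ σ) (hσm : σ ≤ m) (hm : m ≤ 1 / 2)
    (hγL : ((L : ℝ) - 1) * γ ^ 2 ≤ 1 / 2) {Ω : Type*} [MeasurableSpace Ω] (ρ : Measure Ω)
    [IsProbabilityMeasure ρ] (a : Ω → (Fin T → Fin K → ℝ) → Fin T → Fin K)
    (ha : ∀ t, Measurable fun q : Ω × (Fin T → Fin K → ℝ) => a q.1 q.2 t)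
    (hna : ∀ ω l l' t, (∀ s < t, l s = l' s) → a ω l t = a ω l' t) :
    ∃ E : Environment K T, E.drift ≤ 2 * m + 2 * (σ * γ) * ((T / L : ℕ) + 1) ∧
      E.totalVariance = T * ((1 - γ ^ 2) * σ ^ 2) ∧
      T * (σ * γ) / 8 ≤ E.expectedRegret ρ a := by
  obtain ⟨θ, hθ⟩ := exists_le_expectedRegret ρ (noisyEnv K T L m σ γ hγ hσ hσm hm) a ha
    (T * (σ * γ) / 8) fun ω => card_mul_le_sum_detRegret_noisyEnv hK hL hγL (a ω)
      (fun t => (ha t).comp measurable_prodMk_left) (hna ω)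
  exact ⟨_, noisyEnv_drift_le θ, noisyEnv_totalVariance θ, hθ⟩

end Noisy

/-! ### The hidden-window environments for bandit feedback. -/

section Windows

variable {K T N s : ℕ} [NeZero K]

/-- The mean of action `0` when the steps are cut into segments of length `s` and `s` consecutive
segments form a block: it is `m - δ` in segment `(θ b).2` of each block `b` for which `(θ b).1`
holds, and `m + δ` elsewhere. -/
noncomputable def windowMean (m δ : ℝ) (θ : Fin N → Bool × Fin s) (t : ℕ) : ℝ :=
  if ∃ b, (θ b).1 = true ∧ t / s = (θ b).2.val + s * b.val then m - δ else m + δ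

theorem windowMean_mem_Icc {m δ : ℝ} (hδ : 0 ≤ δ) (θ : Fin N → Bool × Fin s) (t : ℕ) :
    windowMean m δ θ t ∈ Set.Icc (m - δ) (m + δ) := by
  unfold windowMean
  split_ifs <;> constructor <;> linarith

/-- The choice in block `b` affects only its own window, so two choices are indistinguishable at
steps outside both windows. -/
theorem windowMean_update_congr (m δ : ℝ) (θ : Fin N → Bool × Fin s) (b : Fin N)
    (c c' : Bool × Fin s) (t : ℕ) (hc : ¬(c.1 = true ∧ t / s = c.2.val + s * b.val))
    (hc' : ¬(c'.1 = true ∧ t / s = c'.2.val + s * b.val)) :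
    windowMean m δ (Function.update θ b c) t = windowMean m δ (Function.update θ b c') t := by
  unfold windowMean
  have key : ∀ d : Bool × Fin s, ¬(d.1 = true ∧ t / s = d.2.val + s * b.val) →
      ((∃ b', (Function.update θ b d b').1 = true ∧
        t / s = (Function.update θ b d b').2.val + s * b'.val) ↔
      ∃ b', b' ≠ b ∧ (θ b').1 = true ∧ t / s = (θ b').2.val + s * b'.val) := by
    intro d hd
    refine exists_congr fun b' => ?_
    by_cases h : b' = b
    · subst h
      simpa using hd
    · simp [h]
  simp only [key c hc, key c' hc']

/-- The mean can change only on entering a designated segment or just after leaving it. Both times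
are counted even if the window is switched off. -/
theorem abs_windowMean_sub_le {m δ : ℝ} (hδ : 0 ≤ δ) (θ : Fin N → Bool × Fin s) (t : ℕ) :
    |windowMean m δ θ t - windowMean m δ θ (t - 1)| ≤ 2 * δ * ∑ b : Fin N,
      ((if t = s * ((θ b).2.val + s * b.val) then 1 else 0) +
        (if t = s * ((θ b).2.val + s * b.val) + s then 1 else 0)) := by
  set w : Fin N → ℝ := fun b => (if t = s * ((θ b).2.val + s * b.val) then 1 else 0) +
    (if t = s * ((θ b).2.val + s * b.val) + s then 1 else 0) with hw
  have hw0 : ∀ b, 0 ≤ w b := fun b => by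
    simp only [hw]
    split_ifs <;> norm_num
  have hsum : 0 ≤ ∑ b, w b := Finset.sum_nonneg fun b _ => hw0 b
  have hchange : ∀ b, ¬(t / s = (θ b).2.val + s * b.val ↔
      (t - 1) / s = (θ b).2.val + s * b.val) → 1 ≤ ∑ b, w b := by
    intro b hb
    refine le_trans ?_ (Finset.single_le_sum (fun b _ => hw0 b) (Finset.mem_univ b))
    have hs : 0 < s := (θ b).2.pos
    have hcases : t = s * ((θ b).2.val + s * b.val) ∨ t = s * ((θ b).2.val + s * b.val) + s := by
      rw [Nat.div_eq_iff hs, Nat.div_eq_iff hs,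
        mul_comm ((θ b).2.val + s * b.val) s] at hb
      omega
    simp only [hw]
    rcases hcases with h | h
    · rw [if_pos h]
      split_ifs <;> norm_num
    · rw [if_pos h]
      split_ifs <;> norm_num
  have hδ2 : 0 ≤ 2 * δ := by linarith
  unfold windowMean
  split_ifs with h1 h2 h2
  · simpa using mul_nonneg hδ2 hsum
  · obtain ⟨b, hb1, hb2⟩ := h1
    have := mul_le_mul_of_nonneg_left
      (hchange b fun h => h2 ⟨b, hb1, h.1 hb2⟩) hδ2
    rw [show m - δ - (m + δ) = -(2 * δ) by ring, abs_neg, abs_of_nonneg hδ2]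
    linarith
  · obtain ⟨b, hb1, hb2⟩ := h2
    have := mul_le_mul_of_nonneg_left
      (hchange b fun h => h1 ⟨b, hb1, h.2 hb2⟩) hδ2
    rw [show m + δ - (m - δ) = 2 * δ by ring, abs_of_nonneg hδ2]
    linarith
  · simpa using mul_nonneg hδ2 hsum

/-- The environment with deterministic losses `windowMean` for action `0`. -/
noncomputable def windowEnv (K T : ℕ) [NeZero K] (m δ : ℝ) (hδ : 0 ≤ δ) (hδm : δ ≤ m)
    (hm : m ≤ 1 / 2) (θ : Fin N → Bool × Fin s) : Environment K T :=
  coinEnv K m (fun _ => 1) (fun t _ => windowMean m δ θ t) ⟨hδ.trans hδm, by linarith⟩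
    fun t _ => by
      have := windowMean_mem_Icc (m := m) hδ θ t
      exact ⟨by linarith [this.1], by linarith [this.2]⟩

variable {m δ : ℝ} {hδ : 0 ≤ δ} {hδm : δ ≤ m} {hm : m ≤ 1 / 2}

theorem windowEnv_coinMean (θ : Fin N → Bool × Fin s) (t : Fin T) :
    coinMean (fun _ => 1) (fun t _ => windowMean m δ θ t) t = windowMean m δ θ t := by
  simp [coinMean]

theorem windowEnv_drift_le (θ : Fin N → Bool × Fin s) :
    (windowEnv K T m δ hδ hδm hm θ).drift ≤ 2 * m + 4 * δ * N := by
  have h0 := windowMean_mem_Icc (m := m) hδ θ 0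
  refine (coinEnv_drift_le (windowMean m δ θ) (windowEnv_coinMean θ) (2 * m) ?_
    (by linarith)).trans ?_
  · rw [abs_le]
    constructor <;> linarith [h0.1, h0.2]
  · refine add_le_add_right ?_ _
    refine (Finset.sum_le_sum fun t _ => abs_windowMean_sub_le hδ θ t).trans ?_
    rw [← Finset.mul_sum, Finset.sum_comm]
    have h1 : ∀ u : ℕ, ∑ t ∈ Finset.range T, (if t = u then (1 : ℝ) else 0) ≤ 1 := by
      intro u
      rw [Finset.sum_ite_eq']
      split_ifs <;> norm_num
    have h2 : ∑ b : Fin N, ∑ t ∈ Finset.range T,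
        ((if t = s * ((θ b).2.val + s * b.val) then (1 : ℝ) else 0) +
          (if t = s * ((θ b).2.val + s * b.val) + s then 1 else 0)) ≤ ∑ _b : Fin N, (2 : ℝ) := by
      refine Finset.sum_le_sum fun b _ => ?_
      rw [Finset.sum_add_distrib]
      linarith [h1 (s * ((θ b).2.val + s * b.val)), h1 (s * ((θ b).2.val + s * b.val) + s)]
    rw [Finset.sum_const, Finset.card_univ, Fintype.card_fin, nsmul_eq_mul] at h2
    have := mul_le_mul_of_nonneg_left h2 (show 0 ≤ 2 * δ by linarith)
    linarith

theorem windowEnv_totalVariance (θ : Fin N → Bool × Fin s) :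
    (windowEnv K T m δ hδ hδm hm θ).totalVariance = 0 := by
  refine coinEnv_totalVariance.trans ?_
  simp

/-- The losses of `windowEnv`. -/
noncomputable def windowLoss (K T : ℕ) [NeZero K] (m δ : ℝ) (θ : Fin N → Bool × Fin s) :
    Fin T → Fin K → ℝ :=
  fun t => oneLoss K m (windowMean m δ θ t)

theorem le_detRegret_windowEnv (hK : 2 ≤ K) (a : (Fin T → Fin K → ℝ) → Fin T → Fin K)
    (ha : ∀ t, Measurable fun l => a l t) (θ : Fin N → Bool × Fin s) :
    ∑ t : Fin T, gapRegret m (windowMean m δ θ t) (a (windowLoss K T m δ θ) t) ≤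
      (windowEnv K T m δ hδ hδm hm θ).detRegret a := by
  refine le_trans (le_of_eq ?_) (le_detRegret_coinEnv hK a ha)
  refine Finset.sum_congr rfl fun t _ => ?_
  rw [← Finset.sum_mul,
    sum_prod_weights_eq_one (p := fun _ : Fin T => coinWeight 1) fun _ => sum_coinWeight 1,
    one_mul, windowEnv_coinMean]
  rfl

/-- Step `i` of segment `j` of block `b`. -/
def windowStep (h : N * s * s ≤ T) (b : Fin N) (q : Fin s × Fin s) : Fin T :=
  Fin.castLE h (finProdFinEquiv (finProdFinEquiv (b, q.1), q.2))

theorem windowStep_div (h : N * s * s ≤ T) (b : Fin N) (q : Fin s × Fin s) :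
    (windowStep h b q).val / s = q.1.val + s * b.val := by
  have hs : 0 < s := q.1.pos
  simp only [windowStep, Fin.val_castLE, finProdFinEquiv_apply_val]
  rw [Nat.add_mul_div_left _ _ hs, Nat.div_eq_of_lt q.2.isLt, zero_add]

/-- Distinct triples of block, segment and offset give distinct steps; the leftover steps contribute
nonnegative regret. -/
theorem sum_windowStep_le (h : N * s * s ≤ T) (r : Fin T → ℝ) (hr : ∀ t, 0 ≤ r t) :
    ∑ b, ∑ q, r (windowStep h b q) ≤ ∑ t, r t := by
  rw [← Fintype.sum_prod_type' (f := fun b q => r (windowStep h b q))]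
  have hinj : Function.Injective fun y : Fin N × Fin s × Fin s => windowStep h y.1 y.2 := by
    rintro ⟨b, j, i⟩ ⟨b', j', i'⟩ hy
    have h1 := finProdFinEquiv.injective (Fin.castLE_injective h hy)
    rw [Prod.mk.injEq] at h1
    have h2 := finProdFinEquiv.injective h1.1
    simp_all
  rw [← Finset.sum_image (f := r) (g := fun y : Fin N × Fin s × Fin s => windowStep h y.1 y.2)
    hinj.injOn]
  exact Finset.sum_le_sum_of_subset_of_nonneg (Finset.subset_univ _) fun t _ _ => hr t

/-- Uniqueness of the block and segment coordinates prevents a window of another block from reaching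
this one. -/
theorem windowMean_update_windowStep (h : N * s * s ≤ T) (θ : Fin N → Bool × Fin s) (b : Fin N)
    (c : Bool × Fin s) (q : Fin s × Fin s) :
    windowMean m δ (Function.update θ b c) (windowStep h b q).val =
      if c = (true, q.1) then m - δ else m + δ := by
  unfold windowMean
  have hiff : (∃ b', (Function.update θ b c b').1 = true ∧ (windowStep h b q).val / s =
      (Function.update θ b c b').2.val + s * b'.val) ↔ c = (true, q.1) := by
    rw [windowStep_div]
    constructor
    · rintro ⟨b', h1, h2⟩
      have h3 : finProdFinEquiv (b, q.1) =
          finProdFinEquiv (b', (Function.update θ b c b').2) := by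
        apply Fin.ext
        simpa only [finProdFinEquiv_apply_val] using h2
      have h4 := finProdFinEquiv.injective h3
      rw [Prod.mk.injEq] at h4
      obtain ⟨rfl, h5⟩ := h4
      rw [Function.update_self] at h1 h5
      exact Prod.ext h1 h5.symm
    · rintro rfl
      exact ⟨b, by simp⟩
  simp only [hiff]

/-- Within one block, the regrets over all choices of the window add up to at least `s² δ`: a
learner that never plays action `0` inside a window does not notice it. -/
theorem le_sum_windowRegret (h : N * s * s ≤ T) (hδ : 0 ≤ δ)
    (a : (Fin T → Fin K → ℝ) → Fin T → Fin K)
    (hb : ∀ l l' t, (∀ r < t, l r (a l r) = l' r (a l r)) → a l t = a l' t)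
    (θ : Fin N → Bool × Fin s) (b : Fin N) :
    s * s * δ ≤ ∑ c : Bool × Fin s, ∑ q,
      gapRegret m (windowMean m δ (Function.update θ b c) (windowStep h b q).val)
        (a (windowLoss K T m δ (Function.update θ b c)) (windowStep h b q)) := by
  rcases Nat.eq_zero_or_pos s with hs | hs
  · subst hs
    simp
  -- Reference run with no window in block `b`. All `s` choices `(false, j)` give this run, so
  -- together they weigh as much as the `s` possible windows. With `n j` plays of action `0` in
  -- segment `j`, they contribute `sδ ∑ n j`, which offsets the loss in the bounds `sδ(1 - n j)` for
  -- the windows.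
  set l₀ := windowLoss K T m δ (Function.update θ b (false, ⟨0, hs⟩)) with hl₀
  set n : Fin s → ℝ := fun j => ∑ i, if a l₀ (windowStep h b (j, i)) = 0 then 1 else 0 with hn
  have hfalse : ∀ j : Fin s, ∑ q,
      gapRegret m (windowMean m δ (Function.update θ b (false, j)) (windowStep h b q).val)
        (a (windowLoss K T m δ (Function.update θ b (false, j))) (windowStep h b q)) =
      δ * ∑ j, n j := by
    intro j
    have hl : windowLoss K T m δ (Function.update θ b (false, j)) = l₀ := by
      funext t
      rw [hl₀, windowLoss, windowLoss,
        windowMean_update_congr m δ θ b (false, j) (false, ⟨0, hs⟩) t (by simp) (by simp)]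
    rw [hl, hn, ← Fintype.sum_prod_type'
      (f := fun j i => if a l₀ (windowStep h b (j, i)) = 0 then (1 : ℝ) else 0), Finset.mul_sum]
    refine Finset.sum_congr rfl fun q _ => ?_
    rw [windowMean_update_windowStep, if_neg (by simp)]
    unfold gapRegret
    split_ifs <;> simp [hδ]
  have htrue : ∀ j : Fin s, s * δ * (1 - n j) ≤ ∑ q,
      gapRegret m (windowMean m δ (Function.update θ b (true, j)) (windowStep h b q).val)
        (a (windowLoss K T m δ (Function.update θ b (true, j))) (windowStep h b q)) := by
    intro j
    have hsδ : 0 ≤ s * δ := by positivity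
    by_cases hplay : ∃ i, a l₀ (windowStep h b (j, i)) = 0
    · obtain ⟨i, hi⟩ := hplay
      have h1 : 1 ≤ n j := by
        refine le_trans ?_ (Finset.single_le_sum
          (f := fun i => if a l₀ (windowStep h b (j, i)) = 0 then (1 : ℝ) else 0)
          (fun i _ => by positivity) (Finset.mem_univ i))
        simp [hi]
      exact (mul_nonpos_of_nonneg_of_nonpos hsδ (by linarith)).trans
        (Finset.sum_nonneg fun q _ => gapRegret_nonneg _ _ _)
    · push Not at hplay
      have hnj : n j = 0 := Finset.sum_eq_zero fun i _ => if_neg (hplay i)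
      -- If the reference run avoids action `0` throughout segment `j`, it observes only `m` there
      -- whether or not the window is present. Hence it plays identically and loses `δ` at all `s`
      -- steps of the window.
      have hsame : ∀ i, a l₀ (windowStep h b (j, i)) =
          a (windowLoss K T m δ (Function.update θ b (true, j))) (windowStep h b (j, i)) := by
        intro i
        refine hb _ _ _ fun r hr => ?_
        by_cases hseg : r.val / s = j.val + s * b.val
        · have hr' : r = windowStep h b (j, ⟨r.val % s, Nat.mod_lt _ hs⟩) := by
            apply Fin.ext
            simp only [windowStep, Fin.val_castLE, finProdFinEquiv_apply_val]
            rw [← hseg, Nat.mod_add_div]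
          have h0 : a l₀ r ≠ 0 := by
            rw [hr']
            exact hplay _
          simp only [hl₀, windowLoss, oneLoss] at h0 ⊢
          rw [if_neg h0, if_neg h0]
        · rw [hl₀, windowLoss, windowLoss,
            windowMean_update_congr m δ θ b (false, ⟨0, hs⟩) (true, j) r (by simp)
              (by simpa using hseg)]
      rw [hnj, Fintype.sum_prod_type]
      refine le_trans ?_ (Finset.single_le_sum (fun j' _ => Finset.sum_nonneg fun i _ =>
        gapRegret_nonneg _ _ _) (Finset.mem_univ j))
      have hterm : ∀ i : Fin s, gapRegret m
          (windowMean m δ (Function.update θ b (true, j)) (windowStep h b (j, i)).val)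
          (a (windowLoss K T m δ (Function.update θ b (true, j))) (windowStep h b (j, i))) = δ := by
        intro i
        rw [windowMean_update_windowStep, if_pos rfl, ← hsame, gapRegret, if_neg (hplay i)]
        simp [hδ]
      simp [hterm]
  rw [Fintype.sum_prod_type, Fintype.sum_bool]
  simp only [hfalse]
  have h2 := Finset.sum_le_sum fun j (_ : j ∈ Finset.univ) => htrue j
  rw [← Finset.mul_sum, Finset.sum_sub_distrib] at h2
  simp only [Finset.sum_const, Finset.card_univ, Fintype.card_fin, nsmul_eq_mul, mul_one]
    at h2 ⊢
  linarith

theorem exists_windowEnv_le_expectedRegret (hK : 2 ≤ K) (hs : 1 ≤ s) (h : N * s * s ≤ T)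
    (hδ : 0 ≤ δ) (hδm : δ ≤ m) (hm : m ≤ 1 / 2) {Ω : Type*} [MeasurableSpace Ω] (ρ : Measure Ω)
    [IsProbabilityMeasure ρ] (a : Ω → (Fin T → Fin K → ℝ) → Fin T → Fin K)
    (ha : ∀ t, Measurable fun q : Ω × (Fin T → Fin K → ℝ) => a q.1 q.2 t)
    (hb : ∀ ω l l' t, (∀ r < t, l r (a ω l r) = l' r (a ω l r)) → a ω l t = a ω l' t) :
    ∃ E : Environment K T, E.drift ≤ 2 * m + 4 * δ * N ∧ E.totalVariance = 0 ∧
      N * s * δ / 2 ≤ E.expectedRegret ρ a := by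
  have : Nonempty (Fin s) := ⟨⟨0, hs⟩⟩
  suffices hsuff : ∀ ω, (Fintype.card (Fin N → Bool × Fin s) : ℝ) * (N * s * δ / 2) ≤
      ∑ θ : Fin N → Bool × Fin s, (windowEnv K T m δ hδ hδm hm θ).detRegret (a ω) by
    obtain ⟨θ, hθ⟩ := exists_le_expectedRegret ρ
      (fun θ : Fin N → Bool × Fin s => windowEnv K T m δ hδ hδm hm θ) a ha _ hsuff
    exact ⟨_, windowEnv_drift_le θ, windowEnv_totalVariance θ, hθ⟩
  intro ω
  have hsum : ∀ θ : Fin N → Bool × Fin s, ∑ b, ∑ q,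
      gapRegret m (windowMean m δ θ (windowStep h b q).val)
        (a ω (windowLoss K T m δ θ) (windowStep h b q)) ≤
      (windowEnv K T m δ hδ hδm hm θ).detRegret (a ω) := fun θ =>
    (sum_windowStep_le h (fun t => gapRegret m (windowMean m δ θ t)
      (a ω (windowLoss K T m δ θ) t)) fun t => gapRegret_nonneg _ _ _).trans
      (le_detRegret_windowEnv hK (a ω) (fun t => (ha t).comp measurable_prodMk_left) θ)
  refine le_trans ?_ (Finset.sum_le_sum fun θ _ => hsum θ)
  rw [Finset.sum_comm]
  have hN : (Fintype.card (Fin N → Bool × Fin s) : ℝ) * (N * s * δ / 2) =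
      ∑ _b : Fin N, (Fintype.card (Fin N → Bool × Fin s) : ℝ) * (s * δ / 2) := by
    rw [Finset.sum_const, Finset.card_univ, Fintype.card_fin, nsmul_eq_mul]
    ring
  rw [hN]
  refine Finset.sum_le_sum fun b _ => ?_
  refine card_mul_le_sum_of_update _ b _ fun θ => ?_
  refine le_trans (le_of_eq ?_) (le_sum_windowRegret h hδ (a ω) (hb ω) θ b)
  rw [Fintype.card_prod, Fintype.card_bool, Fintype.card_fin]
  push_cast
  ring

end Windows

/-! ### Choice of the parameters. -/

section Parameters

variable {K T : ℕ} [NeZero K] {C V Λ : ℝ} {Ω : Type*} [MeasurableSpace Ω] (ρ : Measure Ω)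
  [IsProbabilityMeasure ρ] (a : Ω → (Fin T → Fin K → ℝ) → Fin T → Fin K)

/-- The lower bound of order `V` against learners with full information. -/
theorem exists_drift_le_expectedRegret (hK : 2 ≤ K) (hC : 1 ≤ C) (hCV : 1 / C ≤ V) (hVT : V ≤ T)
    (ha : ∀ t, Measurable fun q : Ω × (Fin T → Fin K → ℝ) => a q.1 q.2 t)
    (hna : ∀ ω l l' t, (∀ s < t, l s = l' s) → a ω l t = a ω l' t) :
    ∃ E : Environment K T, E.drift ≤ V ∧ E.totalVariance = 0 ∧
      V / (64 * C) ≤ E.expectedRegret ρ a := by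
  have hC0 : 0 < C := by linarith
  have hV0 : 0 < V := lt_of_lt_of_le (by positivity) hCV
  have hT0 : (0 : ℝ) < T := hV0.trans_le hVT
  have hT1 : (1 : ℝ) ≤ T := by exact_mod_cast (Nat.cast_pos.1 hT0 : 0 < T)
  have hm4 : 1 / (4 * C) = 1 / C / 4 := by field_simp
  have hCle : 1 / C ≤ 1 := by rw [div_le_one hC0]; exact hC
  have hVC : V / C ≤ V := div_le_self hV0.le hC
  have hεT : V / (8 * C * T) * T = V / C / 8 := by field_simp
  have hεm : V / (8 * C * T) ≤ 1 / (4 * C) := by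
    rw [div_le_div_iff₀ (by positivity) (by positivity)]
    nlinarith
  -- With `γ = 1` the variance vanishes, and with `L = 1` no earlier step reveals the current sign.
  -- The choice `m = 1/(4C)` keeps the initial cost `2m` below `V/2`.
  obtain ⟨E, h1, h2, h3⟩ := exists_noisyEnv_le_expectedRegret (T := T) (L := 1) (γ := 1)
    (σ := V / (8 * C * T)) (m := 1 / (4 * C)) hK le_rfl (by simp) (by positivity) hεm
    (by linarith) (by norm_num) ρ a ha hna
  refine ⟨E, h1.trans ?_, by rw [h2]; simp, le_trans (le_of_eq ?_) h3⟩
  · rw [mul_one, Nat.div_one]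
    have : V / (8 * C * T) ≤ V / (8 * C * T) * T := le_mul_of_one_le_right (by positivity) hT1
    nlinarith
  · field_simp
    norm_num

/-- The lower bound of order `(Λ V T)^{1/3}` against learners with full information, for
parameters where it is not dominated by the drift. -/
theorem exists_variance_le_expectedRegret (hK : 2 ≤ K) (hC : 1 ≤ C) (hCV : 1 / C ≤ V)
    (hVT : V ≤ T) (hΛ : Λ ≤ C * T) (S : ℝ) (hS : S ^ 3 = Λ * V * T) (hSV : C / 4 * V ≤ S)
    (ha : ∀ t, Measurable fun q : Ω × (Fin T → Fin K → ℝ) => a q.1 q.2 t)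
    (hna : ∀ ω l l' t, (∀ s < t, l s = l' s) → a ω l t = a ω l' t) :
    ∃ E : Environment K T, E.drift ≤ V ∧ E.totalVariance ≤ Λ ∧
      S / (64 * C) ≤ E.expectedRegret ρ a := by
  have hC0 : 0 < C := by linarith
  have hV0 : 0 < V := lt_of_lt_of_le (by positivity) hCV
  have hT0 : (0 : ℝ) < T := hV0.trans_le hVT
  have hT1 : (1 : ℝ) ≤ T := by exact_mod_cast (Nat.cast_pos.1 hT0 : 0 < T)
  have hS0 : 0 < S := lt_of_lt_of_le (by positivity) hSV
  have hCV1 : 1 ≤ C * V := by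
    rw [div_le_iff₀ hC0] at hCV
    linarith
  have hΛ0 : 0 < Λ := by
    have h1 : 0 < Λ * (V * T) := by
      rw [← mul_assoc, ← hS]
      positivity
    exact pos_of_mul_pos_left h1 (by positivity)
  -- The factor `16C³` turns `Λ ≤ CT` into `σ ≤ 1/(4C) = m`.
  set σ : ℝ := √(Λ / (16 * C ^ 3 * T)) with hσ
  have hσ0 : 0 < σ := Real.sqrt_pos.2 (by positivity)
  have hσsq : σ ^ 2 = Λ / (16 * C ^ 3 * T) := Real.sq_sqrt (by positivity)
  set ε : ℝ := S / (8 * C * T) with hε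
  have hε0 : 0 < ε := by positivity
  -- This is where `C/4 * V ≤ S` is needed: it makes `γ = ε/σ` at most one.
  have hεσ : ε ≤ σ := by
    refine Real.le_sqrt_of_sq_le ?_
    rw [hε, div_pow, div_le_div_iff₀ (by positivity) (by positivity)]
    have h1 : C * V * S ^ 2 ≤ 4 * S ^ 3 := by
      nlinarith [mul_le_mul_of_nonneg_right hSV (sq_nonneg S)]
    have h2 : S ^ 2 * (C * V) ≤ 4 * Λ * T * V := by rw [hS] at h1; linarith
    have h3 : S ^ 2 * C ≤ 4 * Λ * T := by
      refine le_of_mul_le_mul_right ?_ hV0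
      linarith
    have h4 := mul_le_mul_of_nonneg_right h3 (show 0 ≤ 16 * C ^ 2 * T by positivity)
    nlinarith
  have hσm : σ ≤ 1 / (4 * C) := by
    refine Real.sqrt_le_iff.2 ⟨by positivity, ?_⟩
    rw [div_pow, div_le_div_iff₀ (by positivity) (by positivity)]
    nlinarith [mul_le_mul_of_nonneg_right hΛ (show 0 ≤ 16 * C ^ 2 by positivity)]
  have hSCVT : S ≤ C * V * T := by
    refine le_of_pow_le_pow_left₀ (n := 3) (by norm_num) (by positivity) ?_
    have hCVT : 1 ≤ C ^ 2 * V ^ 2 * T := by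
      nlinarith [mul_le_mul hCV1 hCV1 (by norm_num) (by positivity)]
    calc S ^ 3 = Λ * (V * T) := by rw [hS]; ring
      _ ≤ C * T * (V * T) := mul_le_mul_of_nonneg_right hΛ (by positivity)
      _ ≤ C * T * (V * T) * (C ^ 2 * V ^ 2 * T) := le_mul_of_one_le_right (by positivity) hCVT
      _ = (C * V * T) ^ 3 := by ring
  have hεV : ε ≤ V / 8 := by
    rw [hε, div_le_div_iff₀ (by positivity) (by positivity)]
    linarith
  -- Block length for which sign changes cost `2εT/y = V/4`. The initial jump and the extra block
  -- cost at most `V/2` and `V/4`. Also `yγ² = 1/4`, within the testing budget.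
  set y : ℝ := 8 * ε * T / V with hy
  have hy0 : 0 < y := by positivity
  have hL1 : 1 ≤ ⌈y⌉₊ := Nat.one_le_iff_ne_zero.2 (Nat.ceil_pos.2 hy0).ne'
  have hLlo : y ≤ ⌈y⌉₊ := Nat.le_ceil y
  have hLhi : (⌈y⌉₊ : ℝ) - 1 ≤ y := by linarith [Nat.ceil_lt_add_one hy0.le]
  have hσγ : σ * (ε / σ) = ε := mul_div_cancel₀ _ hσ0.ne'
  have hγ : ((⌈y⌉₊ : ℝ) - 1) * (ε / σ) ^ 2 ≤ 1 / 2 := by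
    refine (mul_le_mul_of_nonneg_right hLhi (sq_nonneg _)).trans ?_
    have h1 : y * ε ^ 2 ≤ σ ^ 2 / 2 := by
      have h2 : y * ε ^ 2 = S ^ 3 / (64 * C ^ 3 * T ^ 2 * V) := by
        rw [hy, hε]
        field_simp
        norm_num
      rw [h2, hS, hσsq]
      have h3 : 0 < Λ / (C ^ 3 * T) := by positivity
      have h4 : Λ * V * T / (64 * C ^ 3 * T ^ 2 * V) = Λ / (C ^ 3 * T) / 64 := by field_simp
      have h5 : Λ / (16 * C ^ 3 * T) / 2 = Λ / (C ^ 3 * T) / 32 := by field_simp; norm_num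
      linarith
    rw [div_pow, ← mul_div_assoc, div_le_iff₀ (by positivity)]
    linarith
  have hm4 : 1 / (4 * C) = 1 / C / 4 := by field_simp
  have hCle : 1 / C ≤ 1 := by rw [div_le_one hC0]; exact hC
  obtain ⟨E, h1, h2, h3⟩ := exists_noisyEnv_le_expectedRegret (T := T) (L := ⌈y⌉₊) (γ := ε / σ)
    (σ := σ) (m := 1 / (4 * C)) hK hL1
    ⟨by positivity, (div_le_one hσ0).2 hεσ⟩ hσ0.le hσm (by linarith) hγ ρ a ha hna
  rw [hσγ] at h1 h3
  refine ⟨E, h1.trans ?_, ?_, le_trans (le_of_eq ?_) h3⟩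
  · have h4 : ((T / ⌈y⌉₊ : ℕ) : ℝ) ≤ T / y :=
      Nat.cast_div_le.trans (div_le_div_of_nonneg_left hT0.le hy0 hLlo)
    have h5 : ε * (T / y) = V / 8 := by
      rw [hy]
      field_simp
    have h6 := mul_le_mul_of_nonneg_left h4 hε0.le
    linarith
  · rw [h2]
    have h4 : (T : ℝ) * σ ^ 2 = Λ / (16 * C ^ 3) := by
      rw [hσsq]
      field_simp
    have h5 : Λ / (16 * C ^ 3) ≤ Λ :=
      div_le_self hΛ0.le (by nlinarith [one_le_pow₀ (n := 3) hC])
    have h6 : 0 ≤ T * ((ε / σ) ^ 2 * σ ^ 2) := by positivity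
    linarith
  · rw [hε]
    field_simp
    norm_num

/-- The lower bound of order `√(V T)` against learners with bandit feedback. -/
theorem exists_bandit_le_expectedRegret (hK : 2 ≤ K) (hC : 1 ≤ C) (hCV : 1 / C ≤ V) (hVT : V ≤ T)
    (ha : ∀ t, Measurable fun q : Ω × (Fin T → Fin K → ℝ) => a q.1 q.2 t)
    (hb : ∀ ω l l' t, (∀ r < t, l r (a ω l r) = l' r (a ω l r)) → a ω l t = a ω l' t) :
    ∃ E : Environment K T, E.drift ≤ V ∧ E.totalVariance = 0 ∧
      √(V * T) / (128 * C) ≤ E.expectedRegret ρ a := by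
  have hC0 : 0 < C := by linarith
  have hV0 : 0 < V := lt_of_lt_of_le (by positivity) hCV
  have hCV1 : 1 ≤ C * V := by
    rw [div_le_iff₀ hC0] at hCV
    linarith
  set N : ℕ := ⌈V⌉₊ with hN
  have hN0 : 0 < N := Nat.ceil_pos.2 hV0
  have hVN : V ≤ N := Nat.le_ceil V
  have hNT : N ≤ T := Nat.ceil_le.2 hVT
  have hNV : (N : ℝ) ≤ 2 * C * V := by nlinarith [Nat.ceil_lt_add_one hV0.le]
  -- The largest `s` for which `N` blocks of `s²` steps fit into `T`.
  set s : ℕ := Nat.sqrt (T / N) with hs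
  have hs1 : 1 ≤ s := Nat.sqrt_pos.2 (Nat.div_pos hNT hN0)
  have hNs : N * s * s ≤ T := by
    rw [mul_assoc]
    exact (Nat.mul_le_mul_left N (Nat.sqrt_le (T / N))).trans (Nat.mul_div_le T N)
  have hTN : (T : ℝ) ≤ 4 * N * s ^ 2 := by
    have h1 : T / N < (s + 1) * (s + 1) := Nat.lt_succ_sqrt (T / N)
    have h2 : T < (s + 1) * (s + 1) * N := (Nat.div_lt_iff_lt_mul hN0).1 h1
    have h3 : (s + 1) * (s + 1) * N ≤ 4 * N * s ^ 2 := by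
      have : (s + 1) * (s + 1) ≤ 4 * s ^ 2 := by nlinarith
      nlinarith
    exact_mod_cast h2.le.trans h3
  have hm4 : 1 / (4 * C) = 1 / C / 4 := by field_simp
  have hm16 : 1 / (16 * C) = 1 / C / 16 := by field_simp
  have hCle : 1 / C ≤ 1 := by rw [div_le_one hC0]; exact hC
  have hCpos : 0 < 1 / C := by positivity
  obtain ⟨E, h1, h2, h3⟩ := exists_windowEnv_le_expectedRegret (T := T) (N := N) (s := s)
    (δ := 1 / (16 * C)) (m := 1 / (4 * C)) hK hs1 hNs (by positivity) (by linarith)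
    (by linarith) ρ a ha hb
  refine ⟨E, h1.trans ?_, h2, le_trans ?_ h3⟩
  · have h4 : 4 * (1 / (16 * C)) * (N : ℝ) ≤ 4 * (1 / (16 * C)) * (2 * C * V) :=
      mul_le_mul_of_nonneg_left hNV (by positivity)
    have h5 : 4 * (1 / (16 * C)) * (2 * C * V) = V / 2 := by field_simp; norm_num
    linarith
  · have h4 : √(V * T) ≤ 2 * N * s := by
      refine Real.sqrt_le_iff.2 ⟨by positivity, ?_⟩
      calc V * T ≤ N * (4 * N * s ^ 2) := mul_le_mul hVN hTN (by positivity) (by positivity)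
        _ = _ := by ring
    have h5 : (N : ℝ) * s * (1 / (16 * C)) / 2 = 4 * N * s / (128 * C) := by field_simp; norm_num
    rw [h5]
    have : (0 : ℝ) ≤ N * s := by positivity
    exact div_le_div_of_nonneg_right (by linarith) (by positivity)

end Parameters

end DynamicRegret

/-! ### Combining the bounds. -/

theorem mainTheorem8 (C : ℝ) (hC : 1 ≤ C) :
    ∃ c : ℝ, 0 < c ∧
      ∀ (K T : ℕ) (V Λ : ℝ), 2 ≤ K → 1 / C ≤ V → V ≤ T → 0 ≤ Λ → Λ ≤ C * T →
        (∀ (Ω : Type*) [MeasurableSpace Ω] (ρ : Measure Ω) [IsProbabilityMeasure ρ]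
          (A : DynamicRegret.FullInfoAlgorithm Ω K T),
          ∃ E : DynamicRegret.Environment K T, E.drift ≤ V ∧ E.totalVariance ≤ Λ ∧
            c * ((Λ * V * T) ^ (1 / 3 : ℝ) + V) ≤ E.expectedRegret ρ A.play) ∧
        (∀ (Ω : Type*) [MeasurableSpace Ω] (ρ : Measure Ω) [IsProbabilityMeasure ρ]
          (A : DynamicRegret.BanditAlgorithm Ω K T),
          ∃ E : DynamicRegret.Environment K T, E.drift ≤ V ∧ E.totalVariance ≤ Λ ∧
            c * ((Λ * V * T) ^ (1 / 3 : ℝ) + √(V * T)) ≤ E.expectedRegret ρ A.play) := by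
  have hC0 : 0 < C := by linarith
  -- Here `640C² = 5C · 128C`: the first factor pays for replacing a sum by one term, the second is
  -- the weakest constant of the three bounds.
  refine ⟨1 / (640 * C ^ 2), by positivity, fun K T V Λ hK hCV hVT hΛ hΛT => ?_⟩
  have : NeZero K := ⟨by omega⟩
  have hV0 : 0 < V := lt_of_lt_of_le (by positivity) hCV
  have hT0 : (0 : ℝ) < T := hV0.trans_le hVT
  set S : ℝ := (Λ * V * T) ^ (1 / 3 : ℝ) with hSdef
  have hS : S ^ 3 = Λ * V * T := by
    rw [hSdef, ← Real.rpow_natCast, ← Real.rpow_mul (by positivity)]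
    norm_num
  have hVsqrt : V ≤ √(V * T) := Real.le_sqrt_of_sq_le (by nlinarith)
  -- Either term of the sum dominates it up to a factor `5 C`.
  have hbound : ∀ x D : ℝ, x ≤ 5 * C * D → 1 / (640 * C ^ 2) * x ≤ D / (128 * C) := by
    intro x D h
    rw [one_div_mul_eq_div, div_le_div_iff₀ (by positivity) (by positivity)]
    nlinarith [mul_le_mul_of_nonneg_right h (show 0 ≤ 128 * C by positivity)]
  have h64 : ∀ D : ℝ, 0 ≤ D → D / (128 * C) ≤ D / (64 * C) := fun D hD =>
    div_le_div_of_nonneg_left hD (by positivity) (by linarith)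
  have hCmul : ∀ D : ℝ, 0 ≤ D → D ≤ C * D := fun D hD => le_mul_of_one_le_left hD hC
  constructor
  · intro Ω _ ρ _ A
    rcases le_total (C / 4 * V) S with hSV | hSV
    · obtain ⟨E, h1, h2, h3⟩ := DynamicRegret.exists_variance_le_expectedRegret ρ A.play hK hC hCV
        hVT hΛT S hS hSV A.measurable_play A.play_congr
      have hS0 : 0 ≤ S := le_trans (by positivity) hSV
      exact ⟨E, h1, h2, (hbound _ S (by linarith [hCmul V hV0.le, hCmul S hS0])).trans
        ((h64 S hS0).trans h3)⟩
    · obtain ⟨E, h1, h2, h3⟩ := DynamicRegret.exists_drift_le_expectedRegret ρ A.play hK hC hCV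
        hVT A.measurable_play A.play_congr
      exact ⟨E, h1, h2.trans_le hΛ, (hbound _ V (by linarith [hCmul V hV0.le])).trans
        ((h64 V hV0.le).trans h3)⟩
  · intro Ω _ ρ _ A
    by_cases hcase : C / 4 * V ≤ S ∧ √(V * T) ≤ S
    -- Agreement of full loss vectors implies agreement of the observed losses, so the
    -- full-information bound also applies to bandits.
    · obtain ⟨E, h1, h2, h3⟩ := DynamicRegret.exists_variance_le_expectedRegret ρ A.play hK hC hCV
        hVT hΛT S hS hcase.1 A.measurable_play fun ω l l' t h =>
          A.play_congr ω l l' t fun s hs => by rw [h s hs]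
      have hS0 : 0 ≤ S := le_trans (by positivity) hcase.1
      exact ⟨E, h1, h2, (hbound _ S (by linarith [hCmul S hS0, hcase.2])).trans
        ((h64 S hS0).trans h3)⟩
    · obtain ⟨E, h1, h2, h3⟩ := DynamicRegret.exists_bandit_le_expectedRegret ρ A.play hK hC hCV
        hVT A.measurable_play A.play_congr
      refine ⟨E, h1, h2.trans_le hΛ, (hbound _ √(V * T) ?_).trans h3⟩
      have h4 := hCmul √(V * T) (Real.sqrt_nonneg _)
      rw [not_and_or, not_le, not_le] at hcase
      rcases hcase with h | h
      · nlinarith [mul_le_mul_of_nonneg_left hVsqrt hC0.le]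
      · linarith
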